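/- **Theorem 2.5 (sub-optimal $L^\infty$ error estimate for (ML–1)).** Let $N\ge 2$ be an integer, let $f:\mathbb R\to\mathbb R$ be locally Lipschitz continuous, and let $T,\beta,C_0>0$. Put $I=(0,1)$, $Q_T=[0,1]\times[0,T]$. *Continuous problem.* Let $u^0\in C([0,1])$ and let $u=u(x,t)$ satisfy $$u_t=u_{xx}+\frac{N-1}{x}u_x+f(u)\quad(0<x<1,\ 0<t\le T),$$ $$u_x(0,t)=u(1,t)=0\quad(0<t\le T),\qquad u(x,0)=u^0(x)\quad(0<x<1),$$ where all derivatives occurring in $$\kappa(u)=\sum_{k=0}^{2}\|\partial_x^k u\|_{L^\infty(Q_T)}+\sum_{l=1}^{2}\|\partial_t^l u\|_{L^\infty(Q_T)}+\sum_{k=1}^{2}\|\partial_t\partial_x^k u\|_{L^\infty(Q_T)}$$ exist and are continuous on $Q_T$ (so $\kappa(u)<\infty$). *Discretization.* Let $0=x_0<x_1<\dots<x_m=1$ ($m\ge1$), $h_j=x_j-x_{j-1}$, $h=\max_j h_j$, and assume $h\le\beta\min_j h_j$. Let $S_h$ be the space of continuous functions on $[0,1]$ that are affine on each $(x_{j-1},x_j)$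 and vanish at $1$. For $0\le i\le m-1$ let $\phi_i\in S_h$ be the function with $\phi_i(x_j)=\delta_{ij}$, $0\le j\le m$. Put $$(w,v)=\int_0^1x^{N-1}wv\,dx,\qquad A(w,v)=\int_0^1x^{N-1}w_xv_x\,dx,\qquad \langle w,v\rangle=\sum_{i=0}^{m-1}w(x_i)v(x_i)\,(1,\phi_i).$$ Let $\tau_j>0$ ($j\ge0$), $t_n=\sum_{j=0}^{n-1}\tau_j$, $\tau=\sup_{j}\tau_j<\infty$. Let $u_h^n\in S_h$ ($n\ge0$) be a solution of the scheme $$\text{(ML–1)}\qquad \Big\langle\frac{u_h^{n+1}-u_h^n}{\tau_n},\chi\Big\rangle+A(u_h^{n+1},\chi)=(f(u_h^n),\chi)\qquad(\chi\in S_h,\ n\ge0),$$ with an initial value satisfying $\|u_h^0-u^0\|_{L^\infty(I)}\le C_0h^2$. *Conclusion.* For every $K\ge0$ there are positive constants $C,h_0,\tau_0$, depending only on $T,f,K,C_0,N,\beta$, such that whenever $\kappa(u)\le K$, $h\le h_0$ and $\tau\le\tau_0$, $$\sup_{0\le t_n\le T}\|u_h^n-u(\cdot,t_n)\|_{L^\infty(I)}\le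 C(h+\tau).$$ -/

import Mathlib

open Set
open scoped ENNReal NNReal

namespace RadialFEM

noncomputable section

/-- The norm `‖v‖_{L^∞}` of `v` on the set `S`: the supremum of `|v|` over `S`, with value `∞` if
`v` is unbounded on `S`. It is used for functions continuous on a compact set `S`, for which it is
the maximum of `|v|`. -/
def linftyNorm {α : Type*} (S : Set α) (v : α → ℝ) : ℝ≥0∞ := ⨆ p ∈ S, ‖v p‖ₑ

/-! ### The continuous problem -/

/-- The space-time cylinder `Q_T = [0,1] × [0,T]`. -/
def cylinder (T : ℝ) : Set (ℝ × ℝ) := Icc 0 1 ×ˢ Icc 0 T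

/-- The partial derivative in `x` on `[0,1]` of `u = u(x,t)` (one-sided at `x = 0` and `x = 1`). -/
def dX (u : ℝ → ℝ → ℝ) : ℝ → ℝ → ℝ := fun x t => derivWithin (fun y => u y t) (Icc 0 1) x

/-- The partial derivative in `t` on `[0,T]` of `u = u(x,t)` (one-sided at `t = 0` and `t = T`). -/
def dT (T : ℝ) (u : ℝ → ℝ → ℝ) : ℝ → ℝ → ℝ := fun x t => derivWithin (fun s => u x s) (Icc 0 T) t

/-- `v(x,t)` is differentiable in `x` on `[0,1]` for every `t ∈ [0,T]`. -/
def DiffX (T : ℝ) (v : ℝ → ℝ → ℝ) : Prop :=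
  ∀ t ∈ Icc (0 : ℝ) T, DifferentiableOn ℝ (fun y => v y t) (Icc 0 1)

/-- `v(x,t)` is differentiable in `t` on `[0,T]` for every `x ∈ [0,1]`. -/
def DiffT (T : ℝ) (v : ℝ → ℝ → ℝ) : Prop :=
  ∀ x ∈ Icc (0 : ℝ) 1, DifferentiableOn ℝ (fun s => v x s) (Icc 0 T)

/-- `v(x,t)` is jointly continuous on `Q_T`. -/
def ContQ (T : ℝ) (v : ℝ → ℝ → ℝ) : Prop := ContinuousOn (Function.uncurry v) (cylinder T)

/-- The regularity needed for `kappa` below to make sense: the derivatives `∂ₓᵏ u` (`k ≤ 2`),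
`∂ₜˡ u` (`l = 1, 2`) and `∂ₜ ∂ₓᵏ u` (`k = 1, 2`) exist and are continuous on `Q_T`. -/
structure IsSmooth (T : ℝ) (u : ℝ → ℝ → ℝ) : Prop where
  diffX : ∀ k < 2, DiffX T (dX^[k] u)
  contX : ∀ k ≤ 2, ContQ T (dX^[k] u)
  diffT : ∀ l < 2, DiffT T ((dT T)^[l] u)
  contT : ∀ l ∈ Finset.Icc 1 2, ContQ T ((dT T)^[l] u)
  diffTX : ∀ k ∈ Finset.Icc 1 2, DiffT T (dX^[k] u)
  contTX : ∀ k ∈ Finset.Icc 1 2, ContQ T (dT T (dX^[k] u))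

/-- `κ(u) = ∑_{k=0}^{2} ‖∂ₓᵏ u‖ + ∑_{l=1}^{2} ‖∂ₜˡ u‖ + ∑_{k=1}^{2} ‖∂ₜ ∂ₓᵏ u‖`, all norms being
those of `L^∞(Q_T)`. -/
def kappa (T : ℝ) (u : ℝ → ℝ → ℝ) : ℝ≥0∞ :=
  ∑ k ∈ Finset.range 3, linftyNorm (cylinder T) (Function.uncurry (dX^[k] u))
    + ∑ l ∈ Finset.Icc 1 2, linftyNorm (cylinder T) (Function.uncurry ((dT T)^[l] u))
    + ∑ k ∈ Finset.Icc 1 2, linftyNorm (cylinder T) (Function.uncurry (dT T (dX^[k] u)))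

/-- `u` solves `u_t = u_xx + ((N-1)/x) u_x + f(u)` for `0 < x < 1` and `0 < t ≤ T`, with
`u_x(0,t) = u(1,t) = 0` for `0 < t ≤ T` and `u(x,0) = u⁰(x)` for `0 < x < 1`. -/
structure IsSolution (N : ℕ) (f : ℝ → ℝ) (T : ℝ) (u0 : ℝ → ℝ) (u : ℝ → ℝ → ℝ) : Prop where
  equation : ∀ x ∈ Ioo (0 : ℝ) 1, ∀ t ∈ Ioc 0 T,
    dT T u x t = dX (dX u) x t + ((N : ℝ) - 1) / x * dX u x t + f (u x t)
  neumann : ∀ t ∈ Ioc 0 T, dX u 0 t = 0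
  dirichlet : ∀ t ∈ Ioc 0 T, u 1 t = 0
  initial : ∀ x ∈ Ioo (0 : ℝ) 1, u x 0 = u0 x

/-! ### The space mesh and the finite element space -/

/-- A partition `0 = x₀ < x₁ < ⋯ < x_m = 1` with `m ≥ 1`; the values `x j` with `j > m` play no
role. -/
structure Mesh where
  m : ℕ
  m_pos : 0 < m
  x : ℕ → ℝ
  x_zero : x 0 = 0
  x_last : x m = 1
  x_lt : ∀ j < m, x j < x (j + 1)

namespace Mesh

variable (M : Mesh)

/-- The length `x_{j+1} - x_j` of the element `(x_j, x_{j+1})`, for `j = 0, …, m - 1`. -/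
def len (j : ℕ) : ℝ := M.x (j + 1) - M.x j

/-- The granularity parameter `h`, the largest length of an element. -/
def h : ℝ := (Finset.range M.m).sup' (Finset.nonempty_range_iff.2 M.m_pos.ne') M.len

/-- The smallest length of an element. -/
def minLen : ℝ := (Finset.range M.m).inf' (Finset.nonempty_range_iff.2 M.m_pos.ne') M.len

/-- The partition is quasi-uniform with constant `β`. -/
def QuasiUniform (β : ℝ) : Prop := M.h ≤ β * M.minLen

/-- The `P₁` finite element space `S_h`: the continuous functions on `[0,1]` (for piecewise affine
functions, the same as membership in `H¹(0,1)`) that are affine on every element and vanish at `1`.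
Values outside `[0,1]` play no role. -/
def Sh : Set (ℝ → ℝ) :=
  {v | ContinuousOn v (Icc 0 1) ∧
    (∀ j < M.m, ∃ a b : ℝ, ∀ y ∈ Ioo (M.x j) (M.x (j + 1)), v y = a * y + b) ∧ v 1 = 0}

/-- The standard basis (hat) function `φ_i`, `i = 0, …, m - 1`: piecewise affine, with
`φ_i(x_j) = δ_{ij}`. -/
def hat (i : ℕ) (y : ℝ) : ℝ :=
  if y ≤ M.x i then
    if i = 0 then 1 else max 0 ((y - M.x (i - 1)) / (M.x i - M.x (i - 1)))
  else max 0 ((M.x (i + 1) - y) / (M.x (i + 1) - M.x i))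

end Mesh

/-- The weighted inner product `(w,v) = ∫₀¹ x^{N-1} w v dx`. -/
def inner (N : ℕ) (w v : ℝ → ℝ) : ℝ := ∫ x in (0 : ℝ)..1, x ^ (N - 1) * (w x * v x)

/-- The bilinear form `A(w,v) = ∫₀¹ x^{N-1} w_x v_x dx`; on `S_h` the derivatives exist off the
finitely many nodes and are the weak derivatives. -/
def A (N : ℕ) (w v : ℝ → ℝ) : ℝ := ∫ x in (0 : ℝ)..1, x ^ (N - 1) * (deriv w x * deriv v x)

/-- The mass-lumping form `⟨w,v⟩ = ∑_{i=0}^{m-1} w(x_i) v(x_i) (1, φ_i)`. -/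
def lump (N : ℕ) (M : Mesh) (w v : ℝ → ℝ) : ℝ :=
  ∑ i ∈ Finset.range M.m, w (M.x i) * v (M.x i) * inner N (fun _ => 1) (M.hat i)

/-! ### The time partition and the scheme -/

/-- Time increments `τ_j > 0`, `j = 0, 1, …`, with `sup_j τ_j < ∞`. -/
structure TimeSteps where
  dt : ℕ → ℝ
  dt_pos : ∀ j, 0 < dt j
  dt_bdd : BddAbove (range dt)

namespace TimeSteps

/-- The time points `t_n = ∑_{j<n} τ_j`. -/
def t (S : TimeSteps) (n : ℕ) : ℝ := ∑ j ∈ Finset.range n, S.dt j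

/-- `τ = sup_j τ_j`. -/
def tau (S : TimeSteps) : ℝ := ⨆ j, S.dt j

end TimeSteps

/-- `uh n`, `n = 0, 1, …`, is a solution of the scheme (ML-1) (with initial value `uh 0 ∈ S_h`):
`⟨(u_h^{n+1} - u_h^n)/τ_n, χ⟩ + A(u_h^{n+1}, χ) = (f(u_h^n), χ)` for all `χ ∈ S_h`. -/
structure IsML1 (N : ℕ) (f : ℝ → ℝ) (M : Mesh) (S : TimeSteps) (uh : ℕ → ℝ → ℝ) : Prop where
  mem : ∀ n, uh n ∈ M.Sh
  scheme : ∀ n, ∀ χ ∈ M.Sh,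
    lump N M (fun y => (uh (n + 1) y - uh n y) / S.dt n) χ + A N (uh (n + 1)) χ
      = inner N (fun y => f (uh n y)) χ

end

end RadialFEM

namespace RadialFEM

/-! ### The mesh and the finite element space -/

namespace Mesh

variable {M : Mesh}

/-! The proof is a maximum-principle argument for the nodal errors `e^n(x_i) = u_h^n(x_i) - u(x_i,
t_n)`. Testing the scheme with a hat function gives an implicit step with a diagonal mass matrix.
Its stiffness matrix has the sign structure needed for a discrete maximum principle, with no
restriction on the time step (`nodal_le_of_step`).

The delicate term is the space truncation error, the stiffness form of the interpolant of `u` minus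
the exact weak form. After integration by parts it is not `O(h) (1, φ_i)`, because only first-order
control of `u_x` minus its cell slopes is available. It is however dominated by `K h N A(1 - x,
φ_i)`, so the function `c (1 - x)` with `c = K h N` is a barrier that absorbs it
(`sum_le_stiff_one_sub`, `abs_stiff_sub_sum_le`). The barrier is independent of time, so it is paid
once, at cost `O(h)`, and does not accumulate over the steps.

All other errors (time difference, mass lumping, lagged nonlinearity) are `O(h + τ)` times `(1,
φ_i)`, plus a Lipschitz multiple of the current error (`IsML1.abs_error_equation_le`). A discrete
Gronwall induction then closes the estimate (`IsML1.abs_nodal_error_le`). For `h + τ` small the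
bound is at most `1`, which keeps `u_h^n` in a compact interval where `f` is Lipschitz. Between
nodes, the bound on `u_x` costs a further `K h`. -/

theorem x_mono {j k : ℕ} (hjk : j ≤ k) (hk : k ≤ M.m) : M.x j ≤ M.x k := by
  induction k, hjk using Nat.le_induction with
  | base => exact le_rfl
  | succ k _ ih => exact (ih (by omega)).trans (M.x_lt k (by omega)).le

theorem x_mem {j : ℕ} (hj : j ≤ M.m) : M.x j ∈ Icc (0 : ℝ) 1 :=
  ⟨M.x_zero ▸ x_mono (Nat.zero_le j) hj, M.x_last ▸ x_mono hj le_rfl⟩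

theorem len_pos {j : ℕ} (hj : j < M.m) : 0 < M.len j := sub_pos.2 (M.x_lt j hj)

theorem len_le_h {j : ℕ} (hj : j < M.m) : M.len j ≤ M.h :=
  Finset.le_sup' M.len (Finset.mem_range.2 hj)

theorem h_pos : 0 < M.h := (len_pos M.m_pos).trans_le (len_le_h M.m_pos)

theorem Icc_subset {j : ℕ} (hj : j < M.m) : Icc (M.x j) (M.x (j + 1)) ⊆ Icc 0 1 :=
  Icc_subset_Icc (x_mem hj.le).1 (x_mem hj).2

theorem exists_mem_element {y : ℝ} (hy : y ∈ Icc (0 : ℝ) 1) :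
    ∃ j < M.m, y ∈ Icc (M.x j) (M.x (j + 1)) := by
  have key : ∀ k ≤ M.m, 0 < k → y ≤ M.x k → ∃ j < k, y ∈ Icc (M.x j) (M.x (j + 1)) := by
    intro k
    induction k with
    | zero => intro _ h; omega
    | succ k ih =>
      intro hk _ hyk
      rcases le_total (M.x k) y with h | h
      · exact ⟨k, k.lt_succ_self, h, hyk⟩
      · rcases Nat.eq_zero_or_pos k with rfl | hk0
        · exact ⟨0, Nat.one_pos, by rw [M.x_zero]; exact hy.1, hyk⟩
        · obtain ⟨j, hj, hyj⟩ := ih (by omega) hk0 h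
          exact ⟨j, by omega, hyj⟩
  obtain ⟨j, hj, hyj⟩ := key M.m le_rfl M.m_pos (by rw [M.x_last]; exact hy.2)
  exact ⟨j, hj, hyj⟩

/-- The slope on the `j`-th element of the piecewise affine interpolant of `v`. -/
noncomputable def slope (M : Mesh) (v : ℝ → ℝ) (j : ℕ) : ℝ :=
  (v (M.x (j + 1)) - v (M.x j)) / M.len j

theorem Sh_eq_affine {v : ℝ → ℝ} (hv : v ∈ M.Sh) {j : ℕ} (hj : j < M.m) {y : ℝ}
    (hy : y ∈ Icc (M.x j) (M.x (j + 1))) :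
    v y = v (M.x j) + M.slope v j * (y - M.x j) := by
  obtain ⟨hc, haff, -⟩ := hv
  obtain ⟨a, b, hab⟩ := haff j hj
  have hlt := M.x_lt j hj
  have heq : EqOn v (fun y => a * y + b) (Icc (M.x j) (M.x (j + 1))) := by
    refine Set.EqOn.of_subset_closure (s := Ioo (M.x j) (M.x (j + 1))) hab
      (hc.mono (Icc_subset hj)) (by fun_prop) Ioo_subset_Icc_self ?_
    rw [closure_Ioo hlt.ne]
  have h0 := heq (left_mem_Icc.2 hlt.le)
  have h1 := heq (right_mem_Icc.2 hlt.le)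
  have hl : M.x (j + 1) - M.x j ≠ 0 := (sub_pos.2 hlt).ne'
  have hs : M.slope v j = a := by
    simp only [slope, len, h0, h1]
    field_simp
    ring
  rw [heq hy, hs, h0]
  ring

theorem Sh_hasDerivAt {v : ℝ → ℝ} (hv : v ∈ M.Sh) {j : ℕ} (hj : j < M.m) {y : ℝ}
    (hy : y ∈ Ioo (M.x j) (M.x (j + 1))) : HasDerivAt v (M.slope v j) y := by
  have h : HasDerivAt (fun y => v (M.x j) + M.slope v j * (y - M.x j)) (M.slope v j) y := by
    simpa using (((hasDerivAt_id y).sub_const (M.x j)).const_mul (M.slope v j)).const_add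
      (v (M.x j))
  refine h.congr_of_eventuallyEq ?_
  filter_upwards [Ioo_mem_nhds hy.1 hy.2] with z hz
  exact Sh_eq_affine hv hj (Ioo_subset_Icc_self hz)

/-- On an element, the values of `v ∈ S_h` are convex combinations of the two nodal values. -/
theorem Sh_eq_convex {v : ℝ → ℝ} (hv : v ∈ M.Sh) {j : ℕ} (hj : j < M.m) {y : ℝ}
    (hy : y ∈ Icc (M.x j) (M.x (j + 1))) :
    ∃ s ∈ Icc (0 : ℝ) 1, v y = (1 - s) * v (M.x j) + s * v (M.x (j + 1)) := by
  have hl := len_pos hj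
  refine ⟨(y - M.x j) / M.len j, ⟨div_nonneg (sub_nonneg.2 hy.1) hl.le, ?_⟩, ?_⟩
  · rw [div_le_one hl]
    exact sub_le_sub_right hy.2 _
  · rw [Sh_eq_affine hv hj hy, slope]
    field_simp
    ring

theorem hat_node {i j : ℕ} (hi : i < M.m) (hj : j ≤ M.m) :
    M.hat i (M.x j) = if j = i then 1 else 0 := by
  have hr := M.x_lt i hi
  rcases lt_trichotomy j i with h | h | h
  · have h1 : M.x j ≤ M.x i := x_mono h.le hi.le
    have h2 : M.x j ≤ M.x (i - 1) := x_mono (by omega) (by omega)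
    have h3 := M.x_lt (i - 1) (by omega)
    rw [Nat.sub_add_cancel (by omega : 1 ≤ i)] at h3
    rw [hat, if_pos h1, if_neg (by omega), if_neg h.ne]
    exact max_eq_left (div_nonpos_of_nonpos_of_nonneg (by linarith) (by linarith))
  · subst h
    rw [hat, if_pos le_rfl, if_pos rfl]
    split_ifs with h0
    · rfl
    · have h3 := M.x_lt (j - 1) (by omega)
      rw [Nat.sub_add_cancel (by omega : 1 ≤ j)] at h3
      rw [div_self (by linarith)]
      norm_num
  · have h1 : M.x (i + 1) ≤ M.x j := x_mono h hj
    rw [hat, if_neg (by linarith), if_neg (by omega)]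
    exact max_eq_left (div_nonpos_of_nonpos_of_nonneg (by linarith) (by linarith))

theorem hat_nonneg (i : ℕ) (y : ℝ) : 0 ≤ M.hat i y := by
  unfold hat
  split_ifs <;> first | exact zero_le_one | exact le_max_left _ _

theorem hat_continuous {i : ℕ} (hi : i < M.m) : Continuous (M.hat i) := by
  have hr := M.x_lt i hi
  unfold hat
  refine Continuous.if_le ?_ (by fun_prop) continuous_id continuous_const ?_
  · split_ifs <;> fun_prop
  · rintro y rfl
    rw [div_self (sub_pos.2 hr).ne']
    split_ifs with h0
    · norm_num
    · have h3 := M.x_lt (i - 1) (by omega)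
      rw [Nat.sub_add_cancel (by omega : 1 ≤ i)] at h3
      rw [div_self (sub_pos.2 h3).ne']

theorem hat_eq_zero_of_left {i j : ℕ} (hi : i < M.m) (hji : j + 1 < i) {y : ℝ}
    (hy : y ≤ M.x (j + 1)) : M.hat i y = 0 := by
  have h2 : M.x (j + 1) ≤ M.x (i - 1) := x_mono (by omega) (by omega)
  have h3 := M.x_lt (i - 1) (by omega)
  rw [Nat.sub_add_cancel (by omega : 1 ≤ i)] at h3
  rw [hat, if_pos (by linarith), if_neg (by omega)]
  exact max_eq_left (div_nonpos_of_nonpos_of_nonneg (by linarith) (by linarith))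

theorem hat_eq_zero_of_right {i j : ℕ} (hij : i < j) (hj : j ≤ M.m) {y : ℝ}
    (hy : M.x j ≤ y) : M.hat i y = 0 := by
  have h2 : M.x (i + 1) ≤ M.x j := x_mono hij hj
  have h3 := M.x_lt i (by omega)
  rw [hat, if_neg (by linarith)]
  exact max_eq_left (div_nonpos_of_nonpos_of_nonneg (by linarith) (by linarith))

theorem hat_mem_Sh {i : ℕ} (hi : i < M.m) : M.hat i ∈ M.Sh := by
  refine ⟨(hat_continuous hi).continuousOn, fun j hj => ?_, ?_⟩
  · rcases lt_trichotomy j i with h | h | h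
    · rcases Nat.lt_or_ge (j + 1) i with h' | h'
      · refine ⟨0, 0, fun y hy => ?_⟩
        rw [hat_eq_zero_of_left hi h' hy.2.le]
        ring
      · obtain rfl : i = j + 1 := by omega
        refine ⟨1 / (M.x (j + 1) - M.x j), -M.x j / (M.x (j + 1) - M.x j), fun y hy => ?_⟩
        have h3 := M.x_lt j hj
        rw [hat, if_pos hy.2.le, if_neg (by omega), Nat.add_sub_cancel,
          max_eq_right (div_nonneg (by linarith [hy.1]) (by linarith))]
        ring
    · subst h
      refine ⟨-1 / (M.x (j + 1) - M.x j), M.x (j + 1) / (M.x (j + 1) - M.x j), fun y hy => ?_⟩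
      have h3 := M.x_lt j hj
      rw [hat, if_neg (by linarith [hy.1]),
        max_eq_right (div_nonneg (by linarith [hy.2]) (by linarith))]
      ring
    · refine ⟨0, 0, fun y hy => ?_⟩
      rw [hat_eq_zero_of_right h hj.le hy.1.le]
      ring
  · rw [← M.x_last, hat_node hi le_rfl, if_neg hi.ne']

/-- A hat function lives on the elements touching its node. This localisation is why replacing
values at `x` by values at `x_i` in the lumped form costs only `O(h)`. -/
theorem abs_sub_le_of_hat_ne_zero {i : ℕ} (hi : i < M.m) {y : ℝ} (hy : y ∈ Icc (0 : ℝ) 1)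
    (hne : M.hat i y ≠ 0) : |y - M.x i| ≤ M.h := by
  obtain ⟨j, hj, hyj⟩ := M.exists_mem_element hy
  have hl := len_le_h hj
  rw [len] at hl
  have h1 : ¬ j + 1 < i := fun h => hne (hat_eq_zero_of_left hi h hyj.2)
  have h2 : ¬ i < j := fun h => hne (hat_eq_zero_of_right h hj.le hyj.1)
  rw [abs_le]
  obtain rfl | rfl : i = j ∨ i = j + 1 := by omega
  all_goals constructor <;> linarith [hyj.1, hyj.2]

end Mesh

/-! ### The stiffness form on nodal values -/

variable {M : Mesh} {N : ℕ}

/-- The form `A(I_h z, I_h v)`, where `I_h` is the nodal interpolation. -/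
noncomputable def stiff (N : ℕ) (M : Mesh) (z v : ℝ → ℝ) : ℝ :=
  ∑ j ∈ Finset.range M.m,
    (∫ x in M.x j..M.x (j + 1), x ^ (N - 1)) * (M.slope z j * M.slope v j)

theorem integral_eq_sum_elements {g : ℝ → ℝ}
    (hg : ∀ j < M.m, IntervalIntegrable g MeasureTheory.volume (M.x j) (M.x (j + 1))) :
    ∫ x in (0 : ℝ)..1, g x = ∑ j ∈ Finset.range M.m, ∫ x in M.x j..M.x (j + 1), g x := by
  rw [intervalIntegral.sum_integral_adjacent_intervals hg, M.x_zero, M.x_last]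

/-- The right-hand form sees only nodal values, so the error `u_h - u`, which is not in `S_h`, can
be inserted in it directly. -/
theorem A_eq_stiff {w v : ℝ → ℝ} (hw : w ∈ M.Sh) (hv : v ∈ M.Sh) :
    A N w v = stiff N M w v := by
  have heq : ∀ j < M.m, EqOn (fun x => x ^ (N - 1) * (M.slope w j * M.slope v j))
      (fun x => x ^ (N - 1) * (deriv w x * deriv v x)) (Ioo (M.x j) (M.x (j + 1))) := by
    intro j hj x hx
    simp only [(Mesh.Sh_hasDerivAt hw hj hx).deriv, (Mesh.Sh_hasDerivAt hv hj hx).deriv]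
  rw [A, integral_eq_sum_elements (M := M)]
  · refine Finset.sum_congr rfl fun j hj => ?_
    have hj := Finset.mem_range.1 hj
    rw [← intervalIntegral.integral_congr_Ioo_of_le (M.x_lt j hj).le (heq j hj),
      intervalIntegral.integral_mul_const]
  · intro j hj
    refine IntervalIntegrable.congr_uIoo ?_ (uIoo_of_le (M.x_lt j hj).le ▸ heq j hj)
    exact Continuous.intervalIntegrable (by fun_prop) _ _

/-- Integration by parts of the radial Laplacian of `∫ w` against a finite element function. -/
theorem inner_eq_neg_sum (hN : 2 ≤ N) {g w w' v : ℝ → ℝ} (hw : ContinuousOn w (Icc 0 1))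
    (hw' : ContinuousOn w' (Icc 0 1)) (hd : ∀ x ∈ Ioo (0 : ℝ) 1, HasDerivAt w (w' x) x)
    (hg : ∀ x ∈ Ioo (0 : ℝ) 1, g x = w' x + ((N : ℝ) - 1) / x * w x) (hv : v ∈ M.Sh) :
    inner N g v = -∑ j ∈ Finset.range M.m,
      M.slope v j * ∫ x in M.x j..M.x (j + 1), x ^ (N - 1) * w x := by
  obtain ⟨p, rfl⟩ : ∃ p, N = p + 2 := ⟨N - 2, by omega⟩
  simp only [show p + 2 - 1 = p + 1 from rfl] at *
  -- The weight turns the singular operator into an exact derivative: `x^(N-1) (w' + (N-1)/x w) =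
  -- (x^(N-1) w)'`.
  set F : ℝ → ℝ := fun x => x ^ (p + 1) * w x with hF
  set F' : ℝ → ℝ := fun x => ((p : ℝ) + 1) * x ^ p * w x + x ^ (p + 1) * w' x with hF'
  have hFc : ContinuousOn F (Icc 0 1) := by fun_prop
  have hFc' : ContinuousOn F' (Icc 0 1) := by fun_prop
  have hFd : ∀ x ∈ Ioo (0 : ℝ) 1, HasDerivAt F (F' x) x := by
    intro x hx
    have := (hasDerivAt_pow (p + 1) x).mul (hd x hx)
    refine this.congr_deriv ?_
    simp [hF']
  have h1 : inner (p + 2) g v = ∫ x in (0 : ℝ)..1, v x * F' x := by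
    refine intervalIntegral.integral_congr_Ioo_of_le zero_le_one fun x hx => ?_
    have hx0 : x ≠ 0 := hx.1.ne'
    simp only [hF', hg x hx, show p + 2 - 1 = p + 1 from rfl]
    push_cast
    field_simp
    ring
  have hel : ∀ j < M.m, Icc (M.x j) (M.x (j + 1)) ⊆ Icc 0 1 := fun j hj => Mesh.Icc_subset hj
  rw [h1, integral_eq_sum_elements (M := M)]
  · have h2 : ∀ j ∈ Finset.range M.m, ∫ x in M.x j..M.x (j + 1), v x * F' x
        = (v (M.x (j + 1)) * F (M.x (j + 1)) - v (M.x j) * F (M.x j))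
          - M.slope v j * ∫ x in M.x j..M.x (j + 1), F x := by
      intro j hj
      have hj := Finset.mem_range.1 hj
      have hlt := M.x_lt j hj
      rw [intervalIntegral.integral_mul_deriv_eq_deriv_mul_of_hasDerivAt (u := v) (v := F)
        (u' := fun _ => M.slope v j) (v' := F'), intervalIntegral.integral_const_mul]
      · rw [uIcc_of_le hlt.le]
        exact hv.1.mono (hel j hj)
      · rw [uIcc_of_le hlt.le]
        exact hFc.mono (hel j hj)
      · rw [min_eq_left hlt.le, max_eq_right hlt.le]
        exact fun x hx => Mesh.Sh_hasDerivAt hv hj hx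
      · rw [min_eq_left hlt.le, max_eq_right hlt.le]
        exact fun x hx => hFd x (Ioo_subset_Ioo (Mesh.x_mem hj.le).1 (Mesh.x_mem hj).2 hx)
      · exact intervalIntegrable_const
      · refine ContinuousOn.intervalIntegrable ?_
        rw [uIcc_of_le hlt.le]
        exact hFc'.mono (hel j hj)
    -- The boundary terms telescope; the weight kills the one at `0` and `v 1 = 0` the one at `1`.
    rw [Finset.sum_congr rfl h2, Finset.sum_sub_distrib,
      Finset.sum_range_sub (fun j => v (M.x j) * F (M.x j)), M.x_zero, M.x_last, hv.2.2]
    simp [hF]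
  · intro j hj
    refine ContinuousOn.intervalIntegrable ?_
    rw [uIcc_of_le (M.x_lt j hj).le]
    exact (hv.1.mul hFc').mono (hel j hj)

/-! ### Consistency and the barrier function `1 - x` -/

/-- The quotient `(b^(p+1) - a^(p+1)) / (b - a)` is the sum of the `p + 1` monomials `a^i b^(p-i)`.
Keep one extreme term and bound the others by the smaller or the larger pure power. -/
theorem pow_succ_sub_bounds {a b : ℝ} (ha : 0 ≤ a) (hab : a ≤ b) (p : ℕ) :
    (b - a) * (p * a ^ p + b ^ p) ≤ b ^ (p + 1) - a ^ (p + 1) ∧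
      b ^ (p + 1) - a ^ (p + 1) ≤ (b - a) * (p * b ^ p + a ^ p) := by
  have hb : 0 ≤ b := ha.trans hab
  have hs : 0 ≤ b - a := sub_nonneg.2 hab
  induction p with
  | zero => norm_num
  | succ p ih =>
    have h1 : 0 ≤ (b - a) * (p * a ^ p) * (b - a) := by positivity
    have h2 : 0 ≤ (b - a) * (p * b ^ p) * (b - a) := by positivity
    have h3 := mul_le_mul_of_nonneg_left ih.1 hb
    have h4 := mul_le_mul_of_nonneg_left ih.2 ha
    push_cast
    constructor
    · have e : b ^ (p + 1 + 1) - a ^ (p + 1 + 1)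
          = b * (b ^ (p + 1) - a ^ (p + 1)) + (b - a) * a ^ (p + 1) := by ring
      rw [e]
      refine le_trans ?_ (add_le_add_left h3 _)
      linear_combination h1
    · have e : b ^ (p + 1 + 1) - a ^ (p + 1 + 1)
          = a * (b ^ (p + 1) - a ^ (p + 1)) + (b - a) * b ^ (p + 1) := by ring
      rw [e]
      refine le_trans (add_le_add_left h4 _) ?_
      linear_combination h2

/-- Formally `A(1 - x, v) = (N-1) ∫ x^(N-2) v`, which is comparable to the left-hand sum. The
inequality is proved element by element, after adding a telescoping sum of total zero. -/
theorem sum_le_stiff_one_sub (hN : 2 ≤ N) {v : ℝ → ℝ} (hv1 : v 1 = 0)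
    (hv : ∀ j ≤ M.m, 0 ≤ v (M.x j)) :
    ∑ j ∈ Finset.range M.m,
        (v (M.x j) + v (M.x (j + 1))) * (M.x (j + 1) ^ (N - 1) - M.x j ^ (N - 1))
      ≤ N * stiff N M (fun x => 1 - x) v := by
  obtain ⟨p, rfl⟩ : ∃ p, N = p + 1 := ⟨N - 1, by omega⟩
  have hp : p ≠ 0 := by omega
  simp only [Nat.add_sub_cancel]
  have htel : ∑ j ∈ Finset.range M.m,
      (v (M.x j) * M.x j ^ p - v (M.x (j + 1)) * M.x (j + 1) ^ p) = 0 := by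
    rw [Finset.sum_range_sub' (fun j => v (M.x j) * M.x j ^ p), M.x_zero, M.x_last, hv1,
      zero_pow hp]
    ring
  rw [stiff, ← add_zero (Finset.sum _ _), ← mul_zero (((p + 1 : ℕ) : ℝ)), ← htel,
    Finset.mul_sum, Finset.mul_sum, ← Finset.sum_add_distrib]
  refine Finset.sum_le_sum fun j hj => ?_
  have hj := Finset.mem_range.1 hj
  have hlt := M.x_lt j hj
  have ha := (Mesh.x_mem (M := M) hj.le).1
  have h0 := hv j hj.le
  have h1 := hv (j + 1) hj
  have hb := pow_succ_sub_bounds ha hlt.le p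
  have hsl : M.slope (fun x => 1 - x) j = -1 := by
    have hl : M.x (j + 1) - M.x j ≠ 0 := (sub_pos.2 hlt).ne'
    simp only [Mesh.slope, Mesh.len]
    rw [div_eq_iff hl]
    ring
  rw [hsl, integral_pow, Nat.add_sub_cancel, Mesh.slope, Mesh.len]
  generalize M.x j = a at *
  generalize M.x (j + 1) = b at *
  generalize v a = s at *
  generalize v b = t at *
  have hl : 0 < b - a := sub_pos.2 hlt
  have hp1 : (0 : ℝ) < (p : ℝ) + 1 := by positivity
  -- With `s`, `t` the end values of `v`, the element contributes `q (s - t)`. The bounds on `q`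
  -- give `q (s - t) ≥ (s + t)(b^p - a^p) + (p + 1)(s a^p - t b^p)`, and the last term is the
  -- telescoping one.
  set q : ℝ := (b ^ (p + 1) - a ^ (p + 1)) / (b - a) with hq
  have hq1 : p * a ^ p + b ^ p ≤ q := by
    rw [hq, le_div_iff₀ hl]
    linarith [hb.1]
  have hq2 : q ≤ p * b ^ p + a ^ p := by
    rw [hq, div_le_iff₀ hl]
    linarith [hb.2]
  have e : ((p + 1 : ℕ) : ℝ) *
      ((b ^ (p + 1) - a ^ (p + 1)) / ((p : ℝ) + 1) * (-1 * ((t - s) / (b - a)))) = q * (s - t) := by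
    rw [hq]
    push_cast
    field_simp
    ring
  rw [e]
  push_cast
  have m1 := mul_le_mul_of_nonneg_left hq1 h0
  have m2 := mul_le_mul_of_nonneg_left hq2 h1
  linear_combination m1 + m2

/-- The slope of `U` is the mean of `w = U'` over the element, so the difference has mean zero and a
constant may be subtracted from the weight. This replaces `x^p` by its oscillation, which is what
the barrier can dominate. -/
theorem abs_integral_pow_mul_slope_sub_le {U w : ℝ → ℝ} {K : ℝ}
    (hU : ContinuousOn U (Icc 0 1)) (hUw : ∀ x ∈ Ioo (0 : ℝ) 1, HasDerivAt U (w x) x)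
    (hw : ContinuousOn w (Icc 0 1))
    (hLip : ∀ x ∈ Icc (0 : ℝ) 1, ∀ y ∈ Icc (0 : ℝ) 1, |w x - w y| ≤ K * |x - y|) (hK : 0 ≤ K)
    (p : ℕ) {j : ℕ} (hj : j < M.m) :
    |∫ x in M.x j..M.x (j + 1), x ^ p * (M.slope U j - w x)|
      ≤ K * M.len j ^ 2 * (M.x (j + 1) ^ p - M.x j ^ p) := by
  have hlt := M.x_lt j hj
  have hsub := Mesh.Icc_subset (M := M) hj
  have ha := (Mesh.x_mem (M := M) hj.le).1
  have hl := Mesh.len_pos hj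
  set a := M.x j
  set b := M.x (j + 1)
  have hopen : Ioo a b ⊆ Ioo 0 1 :=
    Ioo_subset_Ioo ha (Mesh.x_mem (M := M) hj).2
  have hwab : ContinuousOn w (uIcc a b) := by
    rw [uIcc_of_le hlt.le]
    exact hw.mono hsub
  obtain ⟨ξ, hξ, hslope⟩ := exists_hasDerivAt_eq_slope U w hlt (hU.mono hsub)
    fun x hx => hUw x (hopen hx)
  have hint : ∫ x in a..b, w x = U b - U a :=
    intervalIntegral.integral_eq_sub_of_hasDerivAt_of_le hlt.le (hU.mono hsub)
      (fun x hx => hUw x (hopen hx)) hwab.intervalIntegrable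
  have hzero : ∫ x in a..b, (M.slope U j - w x) = 0 := by
    rw [intervalIntegral.integral_sub intervalIntegrable_const hwab.intervalIntegrable, hint,
      intervalIntegral.integral_const, Mesh.slope, Mesh.len, smul_eq_mul,
      mul_div_cancel₀ _ (sub_pos.2 hlt).ne']
    ring
  have hshift : ∫ x in a..b, x ^ p * (M.slope U j - w x)
      = ∫ x in a..b, (x ^ p - a ^ p) * (M.slope U j - w x) := by
    have e : ∀ x : ℝ, (x ^ p - a ^ p) * (M.slope U j - w x)
        = x ^ p * (M.slope U j - w x) - a ^ p * (M.slope U j - w x) := fun x => by ring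
    simp only [e]
    rw [intervalIntegral.integral_sub, intervalIntegral.integral_const_mul, hzero]
    · ring
    · exact ContinuousOn.intervalIntegrable (by fun_prop)
    · exact ContinuousOn.intervalIntegrable (by fun_prop)
  rw [hshift]
  have hbound : ∀ x ∈ uIoc a b, ‖(x ^ p - a ^ p) * (M.slope U j - w x)‖
      ≤ (b ^ p - a ^ p) * (K * M.len j) := by
    intro x hx
    rw [uIoc_of_le hlt.le] at hx
    have hx' : x ∈ Icc a b := Ioc_subset_Icc_self hx
    have h1 : a ^ p ≤ x ^ p := pow_le_pow_left₀ ha hx'.1 p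
    have h2 : x ^ p ≤ b ^ p := pow_le_pow_left₀ (ha.trans hx'.1) hx'.2 p
    rw [norm_mul, Real.norm_eq_abs, Real.norm_eq_abs, abs_of_nonneg (sub_nonneg.2 h1)]
    refine mul_le_mul (sub_le_sub_right h2 _) ?_ (abs_nonneg _) (by linarith)
    have h3 : M.slope U j = w ξ := by rw [hslope]; rfl
    rw [h3]
    refine (hLip ξ (hsub (Ioo_subset_Icc_self hξ)) x (hsub hx')).trans ?_
    refine mul_le_mul_of_nonneg_left ?_ hK
    rw [abs_le, Mesh.len]
    constructor <;> linarith [hξ.1, hξ.2, hx'.1, hx'.2]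
  have := intervalIntegral.norm_integral_le_of_norm_le_const hbound
  rw [abs_of_pos (sub_pos.2 hlt)] at this
  refine this.trans_eq ?_
  rw [Mesh.len]
  ring

/-- The consistency error of the interpolation is controlled by the barrier `1 - x`. -/
theorem abs_stiff_sub_sum_le (hN : 2 ≤ N) {U w v : ℝ → ℝ} {K : ℝ}
    (hU : ContinuousOn U (Icc 0 1)) (hUw : ∀ x ∈ Ioo (0 : ℝ) 1, HasDerivAt U (w x) x)
    (hw : ContinuousOn w (Icc 0 1))
    (hLip : ∀ x ∈ Icc (0 : ℝ) 1, ∀ y ∈ Icc (0 : ℝ) 1, |w x - w y| ≤ K * |x - y|) (hK : 0 ≤ K)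
    (hv1 : v 1 = 0) (hv : ∀ j ≤ M.m, 0 ≤ v (M.x j)) :
    |stiff N M U v - ∑ j ∈ Finset.range M.m,
        M.slope v j * ∫ x in M.x j..M.x (j + 1), x ^ (N - 1) * w x|
      ≤ K * M.h * (N * stiff N M (fun x => 1 - x) v) := by
  have hh := Mesh.h_pos (M := M)
  refine le_trans ?_ (mul_le_mul_of_nonneg_left (sum_le_stiff_one_sub hN hv1 hv)
    (mul_nonneg hK hh.le))
  rw [stiff, ← Finset.sum_sub_distrib, Finset.mul_sum]
  refine (Finset.abs_sum_le_sum_abs _ _).trans (Finset.sum_le_sum fun j hj => ?_)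
  have hj := Finset.mem_range.1 hj
  have hlt := M.x_lt j hj
  have hl := Mesh.len_pos hj
  have hwab : ContinuousOn w (uIcc (M.x j) (M.x (j + 1))) := by
    rw [uIcc_of_le hlt.le]
    exact hw.mono (Mesh.Icc_subset hj)
  have e : (∫ x in M.x j..M.x (j + 1), x ^ (N - 1)) * (M.slope U j * M.slope v j)
      - M.slope v j * ∫ x in M.x j..M.x (j + 1), x ^ (N - 1) * w x
      = M.slope v j * ∫ x in M.x j..M.x (j + 1), x ^ (N - 1) * (M.slope U j - w x) := by
    simp only [mul_sub]
    rw [intervalIntegral.integral_sub, intervalIntegral.integral_mul_const]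
    · ring
    · exact ContinuousOn.intervalIntegrable (by fun_prop)
    · exact ContinuousOn.intervalIntegrable (by fun_prop)
  rw [e, abs_mul]
  have hD : 0 ≤ M.x (j + 1) ^ (N - 1) - M.x j ^ (N - 1) :=
    sub_nonneg.2 (pow_le_pow_left₀ (Mesh.x_mem (M := M) hj.le).1 hlt.le _)
  have h0 := hv j hj.le
  have h1 := hv (j + 1) hj
  -- Nonnegativity of the nodal values bounds the difference by the sum; the factor `1 / len` uses
  -- up one of the two powers of `len` in the cell estimate.
  have hs : |M.slope v j| ≤ (v (M.x j) + v (M.x (j + 1))) / M.len j := by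
    rw [Mesh.slope, abs_div, abs_of_pos hl]
    refine div_le_div_of_nonneg_right ?_ hl.le
    rw [abs_le]
    constructor <;> linarith
  calc |M.slope v j| * |∫ x in M.x j..M.x (j + 1), x ^ (N - 1) * (M.slope U j - w x)|
      ≤ (v (M.x j) + v (M.x (j + 1))) / M.len j
        * (K * M.len j ^ 2 * (M.x (j + 1) ^ (N - 1) - M.x j ^ (N - 1))) :=
        mul_le_mul hs (abs_integral_pow_mul_slope_sub_le hU hUw hw hLip hK _ hj) (abs_nonneg _)
          (by positivity)
    _ = K * M.len j * ((v (M.x j) + v (M.x (j + 1)))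
        * (M.x (j + 1) ^ (N - 1) - M.x j ^ (N - 1))) := by
        field_simp
    _ ≤ _ := by
        refine mul_le_mul_of_nonneg_right ?_ (by positivity)
        exact mul_le_mul_of_nonneg_left (Mesh.len_le_h hj) hK

/-! ### The discrete maximum principle -/

/-- At a maximal node, `z` does not decrease on the element to the left, where the hat rises, and
does not increase on the one to the right, where it falls. Every element term is therefore
nonnegative. -/
theorem stiff_hat_nonneg_of_isMax {z : ℝ → ℝ} {i : ℕ} (hi : i < M.m)
    (hz : ∀ j ≤ M.m, z (M.x j) ≤ z (M.x i)) : 0 ≤ stiff N M z (M.hat i) := by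
  refine Finset.sum_nonneg fun j hj => ?_
  have hj := Finset.mem_range.1 hj
  have hl := Mesh.len_pos hj
  have h0 := (Mesh.x_mem (M := M) hj.le).1
  refine mul_nonneg (intervalIntegral.integral_nonneg (M.x_lt j hj).le fun x hx =>
    pow_nonneg (h0.trans hx.1) _) ?_
  rw [Mesh.slope, Mesh.slope, Mesh.hat_node hi hj, Mesh.hat_node hi hj.le, div_mul_div_comm]
  refine div_nonneg ?_ (by positivity)
  have h1 := hz j hj.le
  have h2 := hz (j + 1) hj
  by_cases e1 : j + 1 = i
  · subst e1
    simp only [if_true, if_neg (by omega : ¬ j = j + 1)]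
    linarith
  · by_cases e2 : j = i
    · subst e2
      simp only [if_true, if_neg e1]
      linarith
    · simp [if_neg e1, if_neg e2]

theorem stiff_sub_const_mul (z b v : ℝ → ℝ) (c : ℝ) :
    stiff N M (fun x => z x - c * b x) v = stiff N M z v - c * stiff N M b v := by
  simp only [stiff, Finset.mul_sum, ← Finset.sum_sub_distrib]
  refine Finset.sum_congr rfl fun j _ => ?_
  simp only [Mesh.slope]
  ring

/-- One implicit step: the nodal values of a discrete subsolution grow at most by `τ` times the
size of the right-hand side. -/
theorem nodal_le_of_step {y z : ℝ → ℝ} {G B τ : ℝ} (hτ : 0 < τ) (hGB : 0 ≤ G + τ * B)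
    (hz1 : z 1 ≤ 0) (hy : ∀ i < M.m, y (M.x i) ≤ G)
    (hmass : ∀ i < M.m, 0 < inner N (fun _ => 1) (M.hat i))
    (hstep : ∀ i < M.m, (z (M.x i) - y (M.x i)) / τ * inner N (fun _ => 1) (M.hat i)
      + stiff N M z (M.hat i) ≤ B * inner N (fun _ => 1) (M.hat i)) :
    ∀ i ≤ M.m, z (M.x i) ≤ G + τ * B := by
  obtain ⟨k, hk, hmax⟩ := Finset.exists_max_image (Finset.range (M.m + 1)) (fun i => z (M.x i))
    ⟨0, by simp⟩
  have hk' : k ≤ M.m := by simpa [Nat.lt_succ_iff] using hk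
  have hmax' : ∀ j ≤ M.m, z (M.x j) ≤ z (M.x k) := fun j hj => hmax j (by simp; omega)
  intro i hi
  refine (hmax' i hi).trans ?_
  -- A maximum at `x = 1` is settled by the boundary value. At any other node, including `x = 0`,
  -- the stiffness term may be dropped and the mass divided out.
  rcases hk'.eq_or_lt with rfl | hlt
  · rw [M.x_last]
    linarith
  · have h1 := stiff_hat_nonneg_of_isMax (N := N) hlt hmax'
    have h2 := hstep k hlt
    have h3 : (z (M.x k) - y (M.x k)) / τ ≤ B :=
      le_of_mul_le_mul_right (by linarith) (hmass k hlt)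
    rw [div_le_iff₀ hτ] at h3
    linarith [hy k hlt]

theorem lump_hat {w : ℝ → ℝ} {i : ℕ} (hi : i < M.m) :
    lump N M w (M.hat i) = w (M.x i) * inner N (fun _ => 1) (M.hat i) := by
  rw [lump, Finset.sum_eq_single i]
  · rw [Mesh.hat_node hi hi.le, if_pos rfl, mul_one]
  · intro j hj hji
    rw [Mesh.hat_node hi (Finset.mem_range.1 hj).le, if_neg hji]
    ring
  · intro h
    exact absurd (Finset.mem_range.2 hi) h

theorem inner_one_hat_pos {i : ℕ} (hi : i < M.m) : 0 < inner N (fun _ => 1) (M.hat i) := by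
  have hc : Continuous (M.hat i) := Mesh.hat_continuous hi
  have hlt := M.x_lt i hi
  have h0 := (Mesh.x_mem (M := M) hi.le).1
  have h1 := (Mesh.x_mem (M := M) hi).2
  have hg : Continuous fun x => x ^ (N - 1) * (1 * M.hat i x) := by fun_prop
  refine intervalIntegral.integral_pos zero_lt_one hg.continuousOn
    (fun x hx => mul_nonneg (pow_nonneg hx.1.le _) (mul_nonneg zero_le_one (Mesh.hat_nonneg i x)))
    ⟨(M.x i + M.x (i + 1)) / 2, ⟨by linarith, by linarith⟩, ?_⟩
  refine mul_pos (pow_pos (by linarith) _) (mul_pos one_pos ?_)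
  rw [Mesh.hat, if_neg (by linarith)]
  exact lt_max_of_lt_right (div_pos (by linarith) (by linarith))

theorem abs_inner_hat_le {g : ℝ → ℝ} {i : ℕ} (hi : i < M.m)
    {B : ℝ} (hB : ∀ x ∈ Icc (0 : ℝ) 1, |x - M.x i| ≤ M.h → |g x| ≤ B) :
    |inner N g (M.hat i)| ≤ B * inner N (fun _ => 1) (M.hat i) := by
  have hc : Continuous (M.hat i) := Mesh.hat_continuous hi
  rw [inner, inner, ← intervalIntegral.integral_const_mul, ← Real.norm_eq_abs]
  refine intervalIntegral.norm_integral_le_of_norm_le zero_le_one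
    (Filter.Eventually.of_forall fun x hx => ?_)
    (Continuous.intervalIntegrable (by fun_prop) _ _)
  have hx' : x ∈ Icc (0 : ℝ) 1 := Ioc_subset_Icc_self hx
  have h1 : 0 ≤ x ^ (N - 1) := pow_nonneg hx'.1 _
  have h2 := Mesh.hat_nonneg (M := M) i x
  rw [Real.norm_eq_abs, abs_mul, abs_mul, abs_of_nonneg h1, abs_of_nonneg h2]
  by_cases hne : M.hat i x = 0
  · simp [hne]
  · have h3 := hB x hx' (Mesh.abs_sub_le_of_hat_ne_zero hi hx' hne)
    have := mul_le_mul_of_nonneg_left h3 (mul_nonneg h1 h2)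
    linarith

/-! ### Bounds for the solution of the continuous problem -/

theorem linftyNorm_le_ofReal_iff {α : Type*} {S : Set α} {v : α → ℝ} {c : ℝ} (hc : 0 ≤ c) :
    linftyNorm S v ≤ ENNReal.ofReal c ↔ ∀ p ∈ S, |v p| ≤ c := by
  simp only [linftyNorm, iSup_le_iff, Real.enorm_eq_ofReal_abs, ENNReal.ofReal_le_ofReal_iff hc]

section Regularity

variable {T : ℝ} {u : ℝ → ℝ → ℝ} {K : ℝ≥0}

theorem abs_le_of_linftyNorm_cylinder_le {v : ℝ → ℝ → ℝ}
    (h : linftyNorm (cylinder T) (Function.uncurry v) ≤ K) {x t : ℝ} (hx : x ∈ Icc (0 : ℝ) 1)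
    (ht : t ∈ Icc 0 T) : |v x t| ≤ K := by
  rw [← ENNReal.ofReal_coe_nnreal, linftyNorm_le_ofReal_iff K.coe_nonneg] at h
  exact h (x, t) ⟨hx, ht⟩

theorem abs_dX_iterate_le (hκ : kappa T u ≤ K) {k : ℕ} (hk : k < 3) {x t : ℝ}
    (hx : x ∈ Icc (0 : ℝ) 1) (ht : t ∈ Icc 0 T) : |dX^[k] u x t| ≤ K := by
  refine abs_le_of_linftyNorm_cylinder_le (le_trans ?_ hκ) hx ht
  refine le_trans ?_ (le_trans le_self_add le_self_add)
  exact Finset.single_le_sum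
    (f := fun k => linftyNorm (cylinder T) (Function.uncurry (dX^[k] u)))
    (fun _ _ => zero_le) (Finset.mem_range.2 hk)

theorem abs_dT_iterate_le (hκ : kappa T u ≤ K) {l : ℕ} (hl : l ∈ Finset.Icc 1 2) {x t : ℝ}
    (hx : x ∈ Icc (0 : ℝ) 1) (ht : t ∈ Icc 0 T) : |(dT T)^[l] u x t| ≤ K := by
  refine abs_le_of_linftyNorm_cylinder_le (le_trans ?_ hκ) hx ht
  refine le_trans ?_ (le_trans le_add_self le_self_add)
  exact Finset.single_le_sum
    (f := fun l => linftyNorm (cylinder T) (Function.uncurry ((dT T)^[l] u)))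
    (fun _ _ => zero_le) hl

theorem abs_dT_dX_iterate_le (hκ : kappa T u ≤ K) {k : ℕ} (hk : k ∈ Finset.Icc 1 2) {x t : ℝ}
    (hx : x ∈ Icc (0 : ℝ) 1) (ht : t ∈ Icc 0 T) : |dT T (dX^[k] u) x t| ≤ K := by
  refine abs_le_of_linftyNorm_cylinder_le (le_trans ?_ hκ) hx ht
  refine le_trans ?_ le_add_self
  exact Finset.single_le_sum
    (f := fun k => linftyNorm (cylinder T) (Function.uncurry (dT T (dX^[k] u))))
    (fun _ _ => zero_le) hk

theorem ContQ.continuousOn_slice {v : ℝ → ℝ → ℝ} (hv : ContQ T v) {t : ℝ} (ht : t ∈ Icc 0 T) :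
    ContinuousOn (fun x => v x t) (Icc 0 1) :=
  ContinuousOn.comp (f := fun x : ℝ => (x, t)) hv (by fun_prop) fun _ hx => ⟨hx, ht⟩

variable (hs : IsSmooth T u) (hκ : kappa T u ≤ K)
include hs

theorem IsSmooth.hasDerivWithinAt_x {k : ℕ} (hk : k < 2) {x t : ℝ} (hx : x ∈ Icc (0 : ℝ) 1)
    (ht : t ∈ Icc 0 T) :
    HasDerivWithinAt (fun y => dX^[k] u y t) (dX (dX^[k] u) x t) (Icc 0 1) x :=
  (hs.diffX k hk t ht x hx).hasDerivWithinAt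

include hκ

theorem IsSmooth.abs_sub_le_x {k : ℕ} (hk : k < 2) {x y t : ℝ} (hx : x ∈ Icc (0 : ℝ) 1)
    (hy : y ∈ Icc (0 : ℝ) 1) (ht : t ∈ Icc 0 T) :
    |dX^[k] u x t - dX^[k] u y t| ≤ K * |x - y| := by
  refine (convex_Icc (0 : ℝ) 1).norm_image_sub_le_of_norm_hasDerivWithin_le
    (f := fun y => dX^[k] u y t) (fun z hz => hs.hasDerivWithinAt_x hk hz ht) (fun z hz => ?_) hy hx
  rw [Real.norm_eq_abs, ← Function.iterate_succ_apply' dX]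
  exact abs_dX_iterate_le hκ (by omega) hz ht

theorem IsSmooth.abs_sub_le_t {x s t : ℝ} (hx : x ∈ Icc (0 : ℝ) 1) (hs' : s ∈ Icc 0 T)
    (ht : t ∈ Icc 0 T) : |u x s - u x t| ≤ K * |s - t| :=
  (convex_Icc (0 : ℝ) T).norm_image_sub_le_of_norm_hasDerivWithin_le (f := fun s => u x s)
    (fun r hr => (hs.diffT 0 (by norm_num) x hx r hr).hasDerivWithinAt)
    (fun _ hr => abs_dT_iterate_le hκ (l := 1) (by simp) hx hr) ht hs'

/-- The mixed derivative `u_tx` controls how a time increment varies in space. This measures the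
lumping error, since the scheme samples the difference quotient at the node. -/
theorem IsSmooth.abs_increment_sub_le {x y s t : ℝ} (hx : x ∈ Icc (0 : ℝ) 1)
    (hy : y ∈ Icc (0 : ℝ) 1) (hs' : s ∈ Icc 0 T) (ht : t ∈ Icc 0 T) :
    |(u x s - u x t) - (u y s - u y t)| ≤ K * |s - t| * |x - y| := by
  refine (convex_Icc (0 : ℝ) 1).norm_image_sub_le_of_norm_hasDerivWithin_le
    (f := fun z => u z s - u z t)
    (fun z hz => (hs.hasDerivWithinAt_x (k := 0) (by norm_num) hz hs').sub
      (hs.hasDerivWithinAt_x (k := 0) (by norm_num) hz ht)) (fun z hz => ?_) hy hx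
  exact (convex_Icc (0 : ℝ) T).norm_image_sub_le_of_norm_hasDerivWithin_le
    (f := fun s => dX u z s)
    (fun r hr => (hs.diffTX 1 (by simp) z hz r hr).hasDerivWithinAt)
    (fun _ hr => abs_dT_dX_iterate_le hκ (k := 1) (by simp) hz hr) ht hs'

theorem IsSmooth.abs_backward_difference_sub_le {x s τ : ℝ} (hx : x ∈ Icc (0 : ℝ) 1)
    (hs0 : 0 ≤ s) (hτ : 0 < τ) (hsτ : s + τ ≤ T) :
    |(u x (s + τ) - u x s) / τ - dT T u x (s + τ)| ≤ K * τ := by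
  have hend : s + τ ∈ Icc 0 T := ⟨by linarith, hsτ⟩
  have hsub : Icc s (s + τ) ⊆ Icc 0 T := Icc_subset_Icc hs0 hsτ
  -- Mean value inequality for `u` minus the linear function with the slope at the right end; the
  -- bound on `u_tt` makes the derivative of this difference at most `K τ`.
  have key := (convex_Icc s (s + τ)).norm_image_sub_le_of_norm_hasDerivWithin_le
    (f := fun r => u x r - r * dT T u x (s + τ))
    (f' := fun r => dT T u x r - 1 * dT T u x (s + τ)) (C := K * τ)
    (fun r hr => (((hs.diffT 0 (by norm_num) x hx r (hsub hr)).hasDerivWithinAt).mono hsub).sub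
      ((hasDerivWithinAt_id r _).mul_const _)) (fun r hr => ?_)
    (left_mem_Icc.2 (by linarith)) (right_mem_Icc.2 (by linarith))
  · have e : (u x (s + τ) - u x s) / τ - dT T u x (s + τ)
        = (u x (s + τ) - (s + τ) * dT T u x (s + τ) - (u x s - s * dT T u x (s + τ))) / τ := by
      field_simp
      ring
    rw [e, abs_div, abs_of_pos hτ, div_le_iff₀ hτ]
    rwa [Real.norm_eq_abs, add_sub_cancel_left, Real.norm_eq_abs, abs_of_pos hτ] at key
  · have h1 := (convex_Icc (0 : ℝ) T).norm_image_sub_le_of_norm_hasDerivWithin_le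
      (f := fun s => dT T u x s)
      (fun r hr => (hs.diffT 1 (by norm_num) x hx r hr).hasDerivWithinAt)
      (fun _ hr => abs_dT_iterate_le hκ (l := 2) (by simp) hx hr) hend (hsub hr)
    rw [one_mul]
    refine h1.trans (mul_le_mul_of_nonneg_left ?_ K.coe_nonneg)
    rw [Real.norm_eq_abs, abs_le]
    constructor <;> linarith [hr.1, hr.2]

end Regularity

/-! ### The error equation -/

/-- On an element `v` is a convex combination of its nodal values, and `U` moves by at most `K h`
from either node. -/
theorem abs_Sh_sub_le {v U : ℝ → ℝ} {E K : ℝ} (hv : v ∈ M.Sh) (hK : 0 ≤ K)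
    (hU : ∀ x ∈ Icc (0 : ℝ) 1, ∀ y ∈ Icc (0 : ℝ) 1, |U x - U y| ≤ K * |x - y|)
    (hE : ∀ j ≤ M.m, |v (M.x j) - U (M.x j)| ≤ E) {y : ℝ} (hy : y ∈ Icc (0 : ℝ) 1) :
    |v y - U y| ≤ E + K * M.h := by
  obtain ⟨j, hj, hyj⟩ := M.exists_mem_element hy
  obtain ⟨s, hs, hvy⟩ := Mesh.Sh_eq_convex hv hj hyj
  have hl := Mesh.len_le_h hj
  rw [Mesh.len] at hl
  have hnode : ∀ i ≤ M.m, |M.x i - y| ≤ M.h → |v (M.x i) - U y| ≤ E + K * M.h := by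
    intro i hi hd
    have h1 := hU _ (Mesh.x_mem hi) _ hy
    have h2 := mul_le_mul_of_nonneg_left hd hK
    calc |v (M.x i) - U y| ≤ |v (M.x i) - U (M.x i)| + |U (M.x i) - U y| := abs_sub_le _ _ _
      _ ≤ E + K * M.h := by linarith [hE i hi]
  have ha := abs_le.1 (hnode j hj.le (by rw [abs_le]; constructor <;> linarith [hyj.1, hyj.2]))
  have hb := abs_le.1 (hnode (j + 1) hj (by rw [abs_le]; constructor <;> linarith [hyj.1, hyj.2]))
  have hs' : 0 ≤ 1 - s := by linarith [hs.2]
  have e : v y - U y = (1 - s) * (v (M.x j) - U y) + s * (v (M.x (j + 1)) - U y) := by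
    rw [hvy]
    ring
  rw [e, abs_le]
  have h1 := mul_le_mul_of_nonneg_left ha.1 hs'
  have h2 := mul_le_mul_of_nonneg_left ha.2 hs'
  have h3 := mul_le_mul_of_nonneg_left hb.1 hs.1
  have h4 := mul_le_mul_of_nonneg_left hb.2 hs.1
  constructor <;> linarith

theorem inner_sub_const_add {a g v : ℝ → ℝ} (d : ℝ) (ha : ContinuousOn a (Icc 0 1))
    (hg : ContinuousOn g (Icc 0 1)) (hv : ContinuousOn v (Icc 0 1)) :
    inner N (fun x => a x - d + g x) v
      = inner N a v - d * inner N (fun _ => 1) v + inner N g v := by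
  rw [← uIcc_of_le (zero_le_one' ℝ)] at ha hg hv
  simp only [inner]
  rw [← intervalIntegral.integral_const_mul, ← intervalIntegral.integral_sub,
    ← intervalIntegral.integral_add]
  · congr 1
    ext x
    ring
  all_goals exact ContinuousOn.intervalIntegrable (by fun_prop)

/-- The truncation error of one step of the scheme, up to the contribution of the barrier. -/
theorem IsML1.abs_error_equation_le (hN : 2 ≤ N) {f : ℝ → ℝ} (hfc : Continuous f) {T : ℝ}
    {u0 : ℝ → ℝ} {u : ℝ → ℝ → ℝ} (hu : IsSolution N f T u0 u) (hs : IsSmooth T u) {K : ℝ≥0}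
    (hκ : kappa T u ≤ K) {L : ℝ≥0} (hL : LipschitzOnWith L f (Icc (-((K : ℝ) + 1)) (K + 1)))
    {S : TimeSteps} {uh : ℕ → ℝ → ℝ} (hml : IsML1 N f M S uh) {n : ℕ} {t E : ℝ} (ht0 : 0 ≤ t)
    (htT : t + S.dt n ≤ T) (hE : ∀ j ≤ M.m, |uh n (M.x j) - u (M.x j) t| ≤ E)
    (hE1 : E + K * M.h ≤ 1) {i : ℕ} (hi : i < M.m) :
    |((uh (n + 1) (M.x i) - u (M.x i) (t + S.dt n)) - (uh n (M.x i) - u (M.x i) t)) / S.dt n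
          * inner N (fun _ => 1) (M.hat i)
        + stiff N M (fun x => uh (n + 1) x - u x (t + S.dt n)) (M.hat i)|
      ≤ (L * (E + K * M.h + K * S.dt n) + K * S.dt n + K * M.h)
          * inner N (fun _ => 1) (M.hat i)
        + K * M.h * (N * stiff N M (fun x => 1 - x) (M.hat i)) := by
  have hτ := S.dt_pos n
  have hK := K.coe_nonneg
  have ht : t ∈ Icc 0 T := ⟨ht0, by linarith⟩
  have ht' : t + S.dt n ∈ Icc 0 T := ⟨by linarith, htT⟩
  have htpos : t + S.dt n ∈ Ioc 0 T := ⟨by linarith, htT⟩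
  have hhat := Mesh.hat_mem_Sh hi
  have hxi := Mesh.x_mem (M := M) hi.le
  set s := t + S.dt n with hs_def
  set d := (u (M.x i) s - u (M.x i) t) / S.dt n with hd
  have huc : ContinuousOn (fun x => u x s) (Icc 0 1) :=
    ContQ.continuousOn_slice (hs.contX 0 (by norm_num)) ht'
  have hwc : ContinuousOn (fun x => dX u x s) (Icc 0 1) :=
    ContQ.continuousOn_slice (hs.contX 1 (by norm_num)) ht'
  have hwc' : ContinuousOn (fun x => dX (dX u) x s) (Icc 0 1) :=
    ContQ.continuousOn_slice (hs.contX 2 (by norm_num)) ht'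
  have htc : ContinuousOn (fun x => dT T u x s) (Icc 0 1) :=
    ContQ.continuousOn_slice (hs.contT 1 (by simp)) ht'
  have hgc : ContinuousOn (fun x => dT T u x s - f (u x s)) (Icc 0 1) :=
    htc.sub (hfc.comp_continuousOn huc)
  have hweak := inner_eq_neg_sum (M := M) hN hwc hwc'
    (fun x hx => (hs.hasDerivWithinAt_x (k := 1) (by norm_num) (Ioo_subset_Icc_self hx)
      ht').hasDerivAt (Icc_mem_nhds hx.1 hx.2))
    (g := fun x => dT T u x s - f (u x s))
    (fun x hx => by rw [hu.equation x hx s htpos]; ring) hhat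
  have hcons := abs_stiff_sub_sum_le (M := M) (w := fun x => dX u x s) hN huc
    (fun x hx => (hs.hasDerivWithinAt_x (k := 0) (by norm_num) (Ioo_subset_Icc_self hx)
      ht').hasDerivAt (Icc_mem_nhds hx.1 hx.2)) hwc
    (fun x hx y hy => hs.abs_sub_le_x hκ (k := 1) (by norm_num) hx hy ht') hK hhat.2.2
    (fun j _ => Mesh.hat_nonneg i (M.x j))
  have hscheme := hml.scheme n (M.hat i) hhat
  rw [lump_hat hi, A_eq_stiff (hml.mem (n + 1)) hhat] at hscheme
  have hstiff := stiff_sub_const_mul (N := N) (M := M) (uh (n + 1)) (fun x => u x s) (M.hat i) 1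
  simp only [one_mul] at hstiff
  have hlin := inner_sub_const_add (N := N) d (hfc.comp_continuousOn (hml.mem n).1) hgc hhat.1
  -- In `B`, the `L` term compares `f(u_h^n)` with `f(u)` at the new time: nodal error, then `K h`
  -- inside an element, then `K τ` for the lag. The last two terms are the backward difference error
  -- and the lumping error. The condition `E + K h ≤ 1` keeps `u_h^n` in the interval where `L` is
  -- valid.
  have hres := abs_inner_hat_le (N := N) (M := M) hi
    (g := fun x => (f ∘ uh n) x - d + (dT T u x s - f (u x s)))
    (B := L * (E + K * M.h + K * S.dt n) + K * S.dt n + K * M.h) (fun x hx hxd => by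
      have h1 : |uh n x - u x t| ≤ E + K * M.h :=
        abs_Sh_sub_le (U := fun x => u x t) (hml.mem n) hK
          (fun x hx y hy => hs.abs_sub_le_x hκ (k := 0) (by norm_num) hx hy ht) hE hx
      have h2 : |u x s - u x t| ≤ K * S.dt n := by
        have := hs.abs_sub_le_t hκ hx ht' ht
        rwa [hs_def, add_sub_cancel_left, abs_of_pos hτ] at this
      have h3 : |uh n x - u x s| ≤ E + K * M.h + K * S.dt n := by
        have := abs_sub_le (uh n x) (u x t) (u x s)
        rw [abs_sub_comm (u x t)] at this
        linarith
      have hb : ∀ r ∈ Icc 0 T, |u x r| ≤ K :=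
        fun r hr => abs_dX_iterate_le hκ (k := 0) (by norm_num) hx hr
      have h4 : |f (uh n x) - f (u x s)| ≤ L * (E + K * M.h + K * S.dt n) := by
        have hbs := abs_le.1 (hb s ht')
        have hbt := abs_le.1 (hb t ht)
        have h1' := abs_le.1 h1
        have := hL.dist_le_mul (uh n x) ⟨by linarith, by linarith⟩ (u x s)
          ⟨by linarith, by linarith⟩
        rw [Real.dist_eq, Real.dist_eq] at this
        exact this.trans (mul_le_mul_of_nonneg_left h3 L.coe_nonneg)
      have h5 := hs.abs_backward_difference_sub_le hκ hx ht0 hτ htT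
      have h6 : |(u x s - u x t) / S.dt n - d| ≤ K * M.h := by
        rw [hd, ← sub_div, abs_div, abs_of_pos hτ, div_le_iff₀ hτ]
        have := hs.abs_increment_sub_le hκ hx hxi ht' ht
        rw [show s - t = S.dt n from add_sub_cancel_left t _, abs_of_pos hτ] at this
        have := mul_le_mul_of_nonneg_left hxd (mul_nonneg hK hτ.le)
        linarith
      rw [← hs_def] at h5
      rw [abs_le] at h4 h5 h6 ⊢
      simp only [Function.comp]
      constructor <;> linarith)
  rw [hlin, hweak] at hres
  have hsplit : ((uh (n + 1) (M.x i) - u (M.x i) s) - (uh n (M.x i) - u (M.x i) t)) / S.dt n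
      = (uh (n + 1) (M.x i) - uh n (M.x i)) / S.dt n - d := by
    rw [hd]
    ring
  rw [hsplit, hstiff]
  change _ = inner N (f ∘ uh n) (M.hat i) at hscheme
  rw [abs_le] at hres hcons ⊢
  constructor <;> linarith [hres.1, hres.2, hcons.1, hcons.2]

theorem stiff_neg (z v : ℝ → ℝ) : stiff N M (fun x => -z x) v = -stiff N M z v := by
  simp only [stiff, ← Finset.sum_neg_distrib]
  refine Finset.sum_congr rfl fun j _ => ?_
  simp only [Mesh.slope]
  ring

/-- One step of the error estimate: a bound `G + c (1 - x)` for the nodal errors is propagated. -/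
theorem abs_nodal_le_of_step {e e' : ℝ → ℝ} {G B c τ : ℝ} (hτ : 0 < τ) (hG : 0 ≤ G) (hB : 0 ≤ B)
    (he'1 : e' 1 = 0) (he : ∀ i ≤ M.m, |e (M.x i)| ≤ G + c * (1 - M.x i))
    (hstep : ∀ i < M.m,
      |(e' (M.x i) - e (M.x i)) / τ * inner N (fun _ => 1) (M.hat i) + stiff N M e' (M.hat i)|
        ≤ B * inner N (fun _ => 1) (M.hat i) + c * stiff N M (fun x => 1 - x) (M.hat i)) :
    ∀ i ≤ M.m, |e' (M.x i)| ≤ G + τ * B + c * (1 - M.x i) := by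
  have hGB : 0 ≤ G + τ * B := by positivity
  -- The maximum principle is applied to `e' - c (1 - x)`, and below to `-e' - c (1 - x)`. The
  -- barrier cancels in the time difference and leaves only its stiffness term.
  have hup := nodal_le_of_step (N := N) (M := M) (y := fun x => e x - c * (1 - x))
    (z := fun x => e' x - c * (1 - x)) (G := G) (B := B) hτ hGB (by simp [he'1])
    (fun i hi => by linarith [(abs_le.1 (he i hi.le)).2]) (fun i hi => inner_one_hat_pos hi)
    (fun i hi => by
      rw [stiff_sub_const_mul]
      simp only [sub_sub_sub_cancel_right]
      linarith [(abs_le.1 (hstep i hi)).2])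
  have hlo := nodal_le_of_step (N := N) (M := M) (y := fun x => -e x - c * (1 - x))
    (z := fun x => -e' x - c * (1 - x)) (G := G) (B := B) hτ hGB (by simp [he'1])
    (fun i hi => by linarith [(abs_le.1 (he i hi.le)).1]) (fun i hi => inner_one_hat_pos hi)
    (fun i hi => by
      rw [stiff_sub_const_mul, stiff_neg]
      simp only [sub_sub_sub_cancel_right]
      have h : (-e' (M.x i) - -e (M.x i)) / τ = -((e' (M.x i) - e (M.x i)) / τ) := by ring
      rw [h]
      linarith [(abs_le.1 (hstep i hi)).1])
  intro i hi
  rw [abs_le]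
  constructor <;> linarith [hup i hi, hlo i hi]

namespace TimeSteps

variable (S : TimeSteps)

theorem t_zero : S.t 0 = 0 := by simp [t]

theorem t_succ (n : ℕ) : S.t (n + 1) = S.t n + S.dt n := Finset.sum_range_succ _ _

theorem t_nonneg (n : ℕ) : 0 ≤ S.t n := Finset.sum_nonneg fun j _ => (S.dt_pos j).le

theorem dt_le_tau (n : ℕ) : S.dt n ≤ S.tau := le_ciSup S.dt_bdd n

theorem tau_pos : 0 < S.tau := (S.dt_pos 0).trans_le (S.dt_le_tau 0)

end TimeSteps

/-- The initial condition is given on the open interval and extends to the end points by continuity.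
-/
theorem IsSolution.initial_Icc {f : ℝ → ℝ} {T : ℝ} (hT : 0 < T) {u0 : ℝ → ℝ} {u : ℝ → ℝ → ℝ}
    (hu : IsSolution N f T u0 u) (hu0 : ContinuousOn u0 (Icc 0 1)) (hs : IsSmooth T u) {x : ℝ}
    (hx : x ∈ Icc (0 : ℝ) 1) : u x 0 = u0 x := by
  refine Set.EqOn.of_subset_closure (s := Ioo 0 1) (f := fun x => u x 0) hu.initial
    (ContQ.continuousOn_slice (hs.contX 0 (by norm_num)) (left_mem_Icc.2 hT.le)) hu0
    Ioo_subset_Icc_self ?_ hx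
  rw [closure_Ioo zero_ne_one]

/-- The error bound at the nodes. -/
theorem IsML1.abs_nodal_error_le (hN : 2 ≤ N) {f : ℝ → ℝ} (hfc : Continuous f) {T : ℝ}
    {u0 : ℝ → ℝ} {u : ℝ → ℝ → ℝ} (hu : IsSolution N f T u0 u) (hs : IsSmooth T u) {K : ℝ≥0}
    (hκ : kappa T u ≤ K) {L : ℝ≥0} (hL : LipschitzOnWith L f (Icc (-((K : ℝ) + 1)) (K + 1)))
    {S : TimeSteps} {uh : ℕ → ℝ → ℝ} (hml : IsML1 N f M S uh) {Q : ℝ}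
    (hQ : L * (K * N) + L * K + K ≤ Q)
    (hinit : ∀ j ≤ M.m, |uh 0 (M.x j) - u (M.x j) 0| ≤ Q * (M.h + S.tau))
    (hsmall : (Q * Real.exp ((L + 1) * T) + K * N + K) * (M.h + S.tau) ≤ 1) (n : ℕ)
    (hn : S.t n ≤ T) : ∀ j ≤ M.m, |uh n (M.x j) - u (M.x j) (S.t n)|
      ≤ Q * (M.h + S.tau) * Real.exp ((L + 1) * S.t n) + K * M.h * N * (1 - M.x j) := by
  have hh := Mesh.h_pos (M := M)
  have htau := S.tau_pos
  have hK := K.coe_nonneg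
  have hL0 := L.coe_nonneg
  have hN0 : (0 : ℝ) ≤ N := N.cast_nonneg
  have hQ0 : 0 ≤ Q := le_trans (by positivity) hQ
  induction n with
  | zero =>
    intro j hj
    have h1 := (Mesh.x_mem (M := M) hj).2
    have h2 : 0 ≤ K * M.h * N * (1 - M.x j) := mul_nonneg (by positivity) (by linarith)
    rw [S.t_zero, mul_zero, Real.exp_zero, mul_one]
    linarith [hinit j hj]
  | succ n ih =>
    have hτ := S.dt_pos n
    have hτle := S.dt_le_tau n
    rw [S.t_succ] at hn ⊢
    have ht0 := S.t_nonneg n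
    have ihn := ih (by linarith)
    set ε := M.h + S.tau with hε
    set G := Q * ε * Real.exp ((L + 1) * S.t n) with hG
    have hε0 : 0 < ε := by positivity
    have hG0 : 0 ≤ G := by positivity
    have hQG : Q * ε ≤ G :=
      le_mul_of_one_le_right (by positivity) (Real.one_le_exp (by positivity))
    have hGT : G ≤ Q * ε * Real.exp ((L + 1) * T) := by
      refine mul_le_mul_of_nonneg_left (Real.exp_le_exp.2 ?_) (by positivity)
      exact mul_le_mul_of_nonneg_left (by linarith) (by positivity)
    have hhε : K * M.h ≤ K * ε := mul_le_mul_of_nonneg_left (by linarith) hK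
    have hhτ : K * M.h + K * S.dt n ≤ K * ε := by
      rw [← mul_add]
      exact mul_le_mul_of_nonneg_left (by linarith) hK
    have hhN : K * M.h * N ≤ K * ε * N := mul_le_mul_of_nonneg_right hhε hN0
    have hE : ∀ j ≤ M.m, |uh n (M.x j) - u (M.x j) (S.t n)| ≤ G + K * M.h * N := by
      intro j hj
      have h1 := (Mesh.x_mem (M := M) hj).1
      have h2 : 0 ≤ K * M.h * N * M.x j := mul_nonneg (by positivity) h1
      linarith [ihn j hj]
    set B := L * (G + K * M.h * N + K * M.h + K * S.dt n) + K * S.dt n + K * M.h with hB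
    have hB0 : 0 ≤ B := by positivity
    have hstep := abs_nodal_le_of_step (N := N) (M := M) (e := fun x => uh n x - u x (S.t n))
      (e' := fun x => uh (n + 1) x - u x (S.t n + S.dt n)) hτ hG0 hB0
      (by simp [(hml.mem (n + 1)).2.2, hu.dirichlet (S.t n + S.dt n) ⟨by linarith, hn⟩]) ihn
      (fun i hi => (hml.abs_error_equation_le hN hfc hu hs hκ hL ht0 hn hE (by linarith) hi).trans_eq
        (by ring))
    -- The truncation part of `B` is at most `Q ε`, hence at most `G`. This is the source of the
    -- extra `1` in the growth rate `L + 1`.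
    have hBG : B ≤ (L + 1) * G := by
      have h1 : L * (K * M.h * N + K * M.h + K * S.dt n) ≤ L * (K * ε * N + K * ε) :=
        mul_le_mul_of_nonneg_left (by linarith) hL0
      have h2 := mul_le_mul_of_nonneg_right hQ hε0.le
      rw [hB]
      linarith
    -- Discrete Gronwall step: `1 + (L + 1) τ_n ≤ exp ((L + 1) τ_n)`.
    have hgrow : G + S.dt n * B ≤ Q * ε * Real.exp ((L + 1) * (S.t n + S.dt n)) := by
      have h1 := Real.add_one_le_exp ((L + 1) * S.dt n)
      have h2 := mul_le_mul_of_nonneg_left hBG hτ.le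
      have h3 := mul_le_mul_of_nonneg_left h1 hG0
      rw [mul_add ((L : ℝ) + 1), Real.exp_add, ← mul_assoc, ← hG]
      linarith
    intro j hj
    exact (hstep j hj).trans (by linarith)

end RadialFEM

open RadialFEM in
theorem theorem2p5 (N : ℕ) (hN : 2 ≤ N) (f : ℝ → ℝ) (hf : LocallyLipschitz f)
    (T : ℝ) (hT : 0 < T) (β : ℝ) (hβ : 0 < β) (C₀ : ℝ) (hC₀ : 0 < C₀) (K : ℝ≥0) :
    ∃ C > (0 : ℝ), ∃ h₀ > (0 : ℝ), ∃ τ₀ > (0 : ℝ),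
      ∀ (u0 : ℝ → ℝ) (u : ℝ → ℝ → ℝ), ContinuousOn u0 (Icc 0 1) →
        RadialFEM.IsSolution N f T u0 u → RadialFEM.IsSmooth T u → RadialFEM.kappa T u ≤ K →
      ∀ (M : RadialFEM.Mesh) (S : RadialFEM.TimeSteps) (uh : ℕ → ℝ → ℝ),
        M.QuasiUniform β → M.h ≤ h₀ → S.tau ≤ τ₀ →
        RadialFEM.IsML1 N f M S uh →
        RadialFEM.linftyNorm (Icc 0 1) (fun x => uh 0 x - u0 x) ≤ ENNReal.ofReal (C₀ * M.h ^ 2) →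
        ⨆ (n : ℕ) (_ : S.t n ≤ T),
            RadialFEM.linftyNorm (Icc 0 1) (fun x => uh n x - u x (S.t n))
          ≤ ENNReal.ofReal (C * (M.h + S.tau)) := by
  -- Here `|u| ≤ K`, and the discrete solution will stay within distance `1` of `u`.
  obtain ⟨L, hL⟩ := LocallyLipschitzOn.exists_lipschitzOnWith_of_compact
    (isCompact_Icc (a := -((K : ℝ) + 1)) (b := K + 1)) hf.locallyLipschitzOn
  have hK := K.coe_nonneg
  -- `Q` dominates both the initial error and the truncation constants. In `C`, the summand `K N`
  -- pays for the barrier and `K` for the passage from nodes to all points.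
  set Q : ℝ := C₀ + (L * (K * N) + L * K + K) with hQ
  have hCQ : C₀ ≤ Q := le_add_of_nonneg_right (by positivity)
  have hQ0 : 0 < Q := hC₀.trans_le hCQ
  set C : ℝ := Q * Real.exp ((L + 1) * T) + K * N + K with hC
  have hC0 : 0 < C := by positivity
  -- The threshold `1 / (2 C)` forces `C (h + τ) ≤ 1`; the threshold `1` lets `h ^ 2` be bounded by
  -- `h`.
  have hδ : 0 < min 1 (1 / (2 * C)) := by positivity
  refine ⟨C, hC0, min 1 (1 / (2 * C)), hδ, min 1 (1 / (2 * C)), hδ, ?_⟩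
  intro u0 u hu0 hu hs hκ M S uh _ hh hτ hml hinit
  have hh0 := Mesh.h_pos (M := M)
  have htau := S.tau_pos
  have hh1 : M.h ≤ 1 := hh.trans (min_le_left _ _)
  have hsmall : C * (M.h + S.tau) ≤ 1 := by
    have h1 : M.h + S.tau ≤ 1 / C := by
      have e : 1 / C = 1 / (2 * C) + 1 / (2 * C) := by
        field_simp
        norm_num
      rw [e]
      exact add_le_add (hh.trans (min_le_right _ _)) (hτ.trans (min_le_right _ _))
    rwa [le_div_iff₀ hC0, mul_comm] at h1
  rw [linftyNorm_le_ofReal_iff (by positivity)] at hinit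
  have hnodal := hml.abs_nodal_error_le hN hf.continuous hu hs hκ hL (Q := Q) (by linarith)
    (fun j hj => by
      have hx := Mesh.x_mem (M := M) hj
      rw [hu.initial_Icc hT hu0 hs hx]
      refine (hinit _ hx).trans ?_
      refine mul_le_mul hCQ ?_ (by positivity) hQ0.le
      nlinarith) hsmall
  refine iSup₂_le fun n hn => (linftyNorm_le_ofReal_iff (by positivity)).2 fun x hx => ?_
  have ht : S.t n ∈ Icc 0 T := ⟨S.t_nonneg n, hn⟩
  have hfin := abs_Sh_sub_le (U := fun x => u x (S.t n))
    (E := Q * (M.h + S.tau) * Real.exp ((L + 1) * T) + K * M.h * N) (hml.mem n) hK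
    (fun x hx y hy => hs.abs_sub_le_x hκ (k := 0) (by norm_num) hx hy ht)
    (fun j hj => by
      refine (hnodal n hn j hj).trans (add_le_add ?_ ?_)
      · refine mul_le_mul_of_nonneg_left (Real.exp_le_exp.2 ?_) (by positivity)
        exact mul_le_mul_of_nonneg_left hn (by positivity)
      · exact mul_le_of_le_one_right (by positivity)
          (by linarith [(Mesh.x_mem (M := M) hj).1])) hx
  refine hfin.trans ?_
  have h1 : 0 ≤ (K : ℝ) * N * S.tau := by positivity
  have h2 : 0 ≤ (K : ℝ) * S.tau := by positivity
  rw [hC]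
  linarith
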